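/- Let $n\ge 1$. Let $\mathcal C_n$ be the half-cylinder: an annulus with $n$ marked points on one boundary component and none on the other. The marked points of its universal cover $\overline{\mathcal C}_n$ are labelled in order by $\mathbb Z$, the deck transformations being $i\mapsto i+\ell n$, $\ell\in\mathbb Z$. An edge of $\overline{\mathcal C}_n$ is (the isotopy class of an arc joining) an unordered pair $[i,j]$ of distinct integers; its length is $|j-i|$. An edge of $\mathcal C_n$ is a class of such edges modulo deck transformations; let $\pi$ be the projection; lengths are defined on classes. The vertices of the $4n$-gon are labelled counterclockwise by $\mathbb Z/4n$, and its edges are the unordered pairs of distinct vertices (sides included). On $\overline{\mathcal C}_n$ or on the $4n$-gon, two edges intersect if they can be labelled $[a,b]$, $[c,d]$ with $a\prec c\prec b\prec d$ in the cyclic order of the vertices (on $\mathbb Z$, the cyclic order induced by the linear order). A $k$-crossing is a set of $k$ pairwise intersecting edges; a $k$-crossing on $\mathcal C_n$ is the image under $\pi$ of a $k$-crossing on $\overline{\mathcal C}_n$. A $2$-triangulation of the $4n$-gon is an inclusion-maximal set of edges containing no $3$-crossing. A $2$-triangulation on $\mathcal C_n$ is an inclusion-maximal set $T$ of edges of $\mathcal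 C_n$ such that $\pi^{-1}(T)$ contains no $3$-crossing. A set of edges of the $4n$-gon is $n$-periodic if it is invariant under the rotation by $\pi/2$, that is, $i\mapsto i+n$. For a set $E$ of edges of $\mathcal C_n$ put $$\phi(E)=\{[\,i \bmod 4n,\ j\bmod 4n\,] : [i,j]\in\pi^{-1}(E),\ i\not\equiv j \bmod 4n\}.$$ Theorem. (1) $\phi$ restricts to a bijection from the set of $2$-triangulations on $\mathcal C_n$ onto the set of $n$-periodic $2$-triangulations of the $4n$-gon. (2) $\phi$ restricts to a bijection from the sets of edges of $\mathcal C_n$ of length at most $2n$ onto the $n$-periodic sets of edges of the $4n$-gon. (3) $\phi$ preserves $3$-crossings in both directions: reduction modulo $4n$ sends every $3$-crossing on $\overline{\mathcal C}_n$ formed by edges of length at most $2n$ to a $3$-crossing of the $4n$-gon; a set $E$ of edges of $\mathcal C_n$ of length at most $2n$ is a $3$-crossing on $\mathcal C_n$ if and only if $\phi(E)$ consists of all copies, under rotations by multiples of $\pi/2$, of the edges of some $3$-crossing of the $4n$-gon; and for every set $E$ of edges of $\mathcal C_n$ of length at most $2n$, $\pi^{-1}(E)$ contains no $3$-crossing if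 and only if $\phi(E)$ contains no $3$-crossing. -/

import Mathlib

namespace HalfCylinder

/-- An edge on a vertex set `V`: an unordered pair of distinct vertices. -/
def Edge (V : Type) : Type := {e : Sym2 V // ¬ e.IsDiag}

/-- The edge `e + t`, obtained by adding `t` to both end points of `e`. -/
def Edge.translate {V : Type} [AddGroup V] (e : Edge V) (t : V) : Edge V :=
  ⟨e.1.map (· + t), fun h => e.2 ((Sym2.isDiag_map (add_left_injective t)).1 h)⟩

/-- Two edges on a circularly ordered vertex set intersect if, for some labelling `[a, b]`, `[c, d]`
of their end points, `a ≺ c ≺ b ≺ d` in the cyclic order. -/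
def Edge.Crosses {V : Type} [CircularOrder V] (e f : Edge V) : Prop :=
  ∃ a b c d : V, e.1 = s(a, b) ∧ f.1 = s(c, d) ∧ sbtw a c b ∧ sbtw b d a

/-- A `k`-crossing: a set of `k` pairwise intersecting edges. -/
def IsCrossing {V : Type} [CircularOrder V] (k : ℕ) (C : Set (Edge V)) : Prop :=
  C.encard = k ∧ C.Pairwise Edge.Crosses

/-- A set of edges that contains no `k`-crossing. -/
def CrossingFree {V : Type} [CircularOrder V] (k : ℕ) (S : Set (Edge V)) : Prop :=
  ∀ C ⊆ S, ¬ IsCrossing k C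

/-- A `k`-triangulation of the convex `N`-gon, whose vertices are labelled counterclockwise by
`ZMod N`: a maximal set of edges without `(k + 1)`-crossings. -/
def IsPolygonTriangulation (N k : ℕ) (T : Set (Edge (ZMod N))) : Prop :=
  Maximal (CrossingFree (k + 1)) T

/-- Invariance of a set of edges of the `N`-gon under the rotation that sends each vertex `i` to
`i + n`. For `N = 4 * n` this is the rotation by `π / 2`. -/
def IsPeriodic (N n : ℕ) (S : Set (Edge (ZMod N))) : Prop :=
  ∀ e, e ∈ S ↔ e.translate (n : ZMod N) ∈ S

/-- All rotational copies of the edges in `S` by multiples of `n` vertices. -/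
def rotationOrbit (N n : ℕ) (S : Set (Edge (ZMod N))) : Set (Edge (ZMod N)) :=
  {e | ∃ f ∈ S, ∃ l : ℕ, e = f.translate ((l * n : ℕ) : ZMod N)}

/-- The length `|j - i|` of the edge `[i, j]` on the universal cover of the half-cylinder, whose
vertices are labelled by `ℤ`. -/
def Edge.length (e : Edge ℤ) : ℕ :=
  Sym2.lift ⟨fun i j : ℤ => (j - i).natAbs, fun i j => by dsimp only; omega⟩ e.1

/-- Two edges on the universal cover are translations of each other if they differ by a deck
transformation, that is, by the translation by a multiple of `n`. -/
def deckSetoid (n : ℕ) : Setoid (Edge ℤ) where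
  r e f := ∃ l : ℤ, f = e.translate (l * n)
  iseqv :=
    { refl := fun e => ⟨0, by
        apply Subtype.ext
        simp [Edge.translate]⟩
      symm := by
        rintro e f ⟨l, rfl⟩
        refine ⟨-l, ?_⟩
        apply Subtype.ext
        simp [Edge.translate, Sym2.map_map]
      trans := by
        rintro e f g ⟨l, rfl⟩ ⟨m, rfl⟩
        refine ⟨l + m, ?_⟩
        apply Subtype.ext
        simp [Edge.translate, Sym2.map_map, add_mul, add_assoc] }

/-- The edges of the half-cylinder `C_n` with `n` marked points on one boundary component: the
edges of its universal cover up to deck transformations. -/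
def CylinderEdge (n : ℕ) : Type := Quotient (deckSetoid n)

/-- The covering map on edges. -/
def proj (n : ℕ) (e : Edge ℤ) : CylinderEdge n := Quotient.mk (deckSetoid n) e

/-- The lift of a set of edges of `C_n` to the universal cover. -/
def lift (n : ℕ) (E : Set (CylinderEdge n)) : Set (Edge ℤ) := proj n ⁻¹' E

/-- A `k`-crossing on `C_n`: the projection of a `k`-crossing on the universal cover. -/
def IsCylinderCrossing (n k : ℕ) (E : Set (CylinderEdge n)) : Prop :=
  ∃ C : Set (Edge ℤ), IsCrossing k C ∧ proj n '' C = E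

/-- A `k`-triangulation on `C_n`: a maximal set of edges whose lift has no `(k + 1)`-crossing. -/
def IsCylinderTriangulation (n k : ℕ) (T : Set (CylinderEdge n)) : Prop :=
  Maximal (fun E => CrossingFree (k + 1) (lift n E)) T

/-- Every edge in `E` has length at most `L`. -/
def LengthLE (n L : ℕ) (E : Set (CylinderEdge n)) : Prop :=
  ∀ e ∈ lift n E, e.length ≤ L

/-- The edges of the `N`-gon obtained by reducing edges of the universal cover modulo `N`. -/
def reduceMod (N : ℕ) (S : Set (Edge ℤ)) : Set (Edge (ZMod N)) :=
  {e | ∃ f ∈ S, e.1 = f.1.map (fun i : ℤ => (i : ZMod N))}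

/-- The canonical map `φ`: lift to the universal cover and reduce modulo `4 * n`. -/
def toPolygon (n : ℕ) (E : Set (CylinderEdge n)) : Set (Edge (ZMod (4 * n))) :=
  reduceMod (4 * n) (lift n E)

end HalfCylinder

/-!
Every edge of the `4n`-gon has a lift of length at most `2n`, and this lift is unique up to deck
transformations: only a diameter has two such lifts modulo `4n`, and they differ by a half turn.
Hence the cylinder edges of length at most `2n` are the orbits of the edges of the `4n`-gon under
the rotation by `π / 2`. Short lifts that cross reduce to crossing edges, and conversely the short
lifts of a `3`-crossing of the polygon can be translated so as to cross pairwise.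

For triangulations, an edge longer than `2n` crosses its translates by `n` and `2n`, so a
triangulation `T` of the cylinder has only short edges. To show that `φ(T)` is maximal among all
`3`-crossing-free sets and not only among the periodic ones, let `[a, d]` be a short edge outside
`φ(T)`. By maximality of `T`, adding `[a, d]` and all its rotations creates a `3`-crossing. If it
contains a single rotation of `[a, d]`, this edge alone cannot be added. Otherwise it contains two,
which are consecutive, and either the third edge of the crossing straddles `[a, d]` and
`[a + n, d + n]`, or two rotations of the third edge already block `[a, d]`. If `[x, y]` is a
longest straddling edge, then `[a, y]` and `[x, d + n]` are longer than `[a, d]`. By induction they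
lie in `φ(T)` unless they are blocked by a `3`-crossing, which would already block `[a, d]`; and
together with `[a + n, y + n]` they form a `3`-crossing, a contradiction.
-/

namespace HalfCylinder

section CircularOrder

variable {V W : Type} [CircularOrder V] [CircularOrder W]

theorem Edge.Crosses.symm {e f : Edge V} (h : e.Crosses f) : f.Crosses e := by
  obtain ⟨a, b, c, d, he, hf, hacb, hbda⟩ := h
  exact ⟨c, d, b, a, hf, he.trans Sym2.eq_swap, (hbda.cyclic_left.trans_left hacb).cyclic_left,
    (hacb.cyclic_left.trans_left hbda).cyclic_left⟩

theorem Edge.Crosses.ne {e f : Edge V} (h : e.Crosses f) : e ≠ f := by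
  rintro rfl
  obtain ⟨a, b, c, d, he, hf, hacb, -⟩ := h
  rw [he, Sym2.eq_iff] at hf
  rcases hf with ⟨rfl, rfl⟩ | ⟨rfl, rfl⟩
  · exact sbtw_irrefl_left hacb
  · exact sbtw_irrefl_right hacb

theorem Edge.Crosses.map {φ : V → W} {D : Set V}
    (hφ : ∀ x ∈ D, ∀ y ∈ D, ∀ z ∈ D, sbtw x y z → sbtw (φ x) (φ y) (φ z))
    {g h : Edge V} (hg : ∀ x ∈ g.1, x ∈ D) (hh : ∀ x ∈ h.1, x ∈ D) {e f : Edge W}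
    (he : e.1 = g.1.map φ) (hf : f.1 = h.1.map φ) (hgh : g.Crosses h) : e.Crosses f := by
  obtain ⟨a, b, c, d, hab, hcd, hacb, hbda⟩ := hgh
  simp only [hab, hcd, Sym2.mem_iff, forall_eq_or_imp, forall_eq] at hg hh
  exact ⟨φ a, φ b, φ c, φ d, by rw [he, hab, Sym2.map_mk], by rw [hf, hcd, Sym2.map_mk],
    hφ _ hg.1 _ hh.1 _ hg.2 hacb, hφ _ hg.2 _ hh.2 _ hg.1 hbda⟩

theorem Edge.Crosses.of_map {φ : V → W} {D : Set V}
    (hφ : ∀ x ∈ D, ∀ y ∈ D, ∀ z ∈ D, sbtw (φ x) (φ y) (φ z) → sbtw x y z)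
    {g h : Edge V} (hg : ∀ x ∈ g.1, x ∈ D) (hh : ∀ x ∈ h.1, x ∈ D) {e f : Edge W}
    (he : e.1 = g.1.map φ) (hf : f.1 = h.1.map φ) (hef : e.Crosses f) : g.Crosses h := by
  have preimage {p : Sym2 V} {u v : W} (hp : p.map φ = s(u, v)) :
      ∃ x y, p = s(x, y) ∧ φ x = u ∧ φ y = v := by
    induction p with | _ x y =>
    rcases Sym2.eq_iff.1 hp with ⟨hx, hy⟩ | ⟨hx, hy⟩
    exacts [⟨x, y, rfl, hx, hy⟩, ⟨y, x, Sym2.eq_swap, hy, hx⟩]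
  obtain ⟨a, b, c, d, hab, hcd, hacb, hbda⟩ := hef
  obtain ⟨a, b, hg', rfl, rfl⟩ := preimage (he ▸ hab)
  obtain ⟨c, d, hh', rfl, rfl⟩ := preimage (hf ▸ hcd)
  simp only [hg', hh', Sym2.mem_iff, forall_eq_or_imp, forall_eq] at hg hh
  exact ⟨a, b, c, d, hg', hh', hφ _ hg.1 _ hh.1 _ hg.2 hacb, hφ _ hg.2 _ hh.2 _ hg.1 hbda⟩

theorem isCrossing_three_iff {C : Set (Edge V)} :
    IsCrossing 3 C ↔ ∃ e f g : Edge V, C = {e, f, g} ∧ e.Crosses f ∧ e.Crosses g ∧ f.Crosses g := by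
  constructor
  · rintro ⟨hcard, hcross⟩
    obtain ⟨e, f, g, hef, heg, hfg, rfl⟩ := Set.encard_eq_three.1 hcard
    exact ⟨e, f, g, rfl, hcross (by simp) (by simp) hef, hcross (by simp) (by simp) heg,
      hcross (by simp) (by simp) hfg⟩
  · rintro ⟨e, f, g, rfl, hef, heg, hfg⟩
    refine ⟨Set.encard_eq_three.2 ⟨e, f, g, hef.ne, heg.ne, hfg.ne, rfl⟩, ?_⟩
    simp only [Set.pairwise_insert, Set.pairwise_singleton, Set.mem_insert_iff,
      Set.mem_singleton_iff, forall_eq_or_imp, forall_eq, true_and]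
    exact ⟨fun _ => ⟨hfg, hfg.symm⟩, fun _ => ⟨hef, hef.symm⟩, fun _ => ⟨heg, heg.symm⟩⟩

theorem crossingFree_three_iff {S : Set (Edge V)} : CrossingFree 3 S ↔
    ∀ e ∈ S, ∀ f ∈ S, ∀ g ∈ S, e.Crosses f → e.Crosses g → ¬ f.Crosses g := by
  constructor
  · intro hS e he f hf g hg hef heg hfg
    refine hS {e, f, g} ?_ (isCrossing_three_iff.2 ⟨e, f, g, rfl, hef, heg, hfg⟩)
    rintro x (rfl | rfl | rfl) <;> assumption
  · intro h C hCS hC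
    obtain ⟨e, f, g, rfl, hef, heg, hfg⟩ := isCrossing_three_iff.1 hC
    exact h e (hCS (by simp)) f (hCS (by simp)) g (hCS (by simp)) hef heg hfg

theorem CrossingFree.maximal_three {S : Set (Edge V)} (hS : CrossingFree 3 S)
    (h : ∀ e ∉ S, ∃ f ∈ S, ∃ g ∈ S, e.Crosses f ∧ e.Crosses g ∧ f.Crosses g) :
    Maximal (CrossingFree 3) S := by
  refine ⟨hS, fun T hT hST e heT => ?_⟩
  by_contra heS
  obtain ⟨f, hf, g, hg, hef, heg, hfg⟩ := h e heS
  exact crossingFree_three_iff.1 hT e heT f (hST hf) g (hST hg) hef heg hfg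

end CircularOrder

section Translation

variable {V : Type}

/-- The edge `[x, y]`. -/
def Edge.mk (x y : V) (h : x ≠ y) : Edge V := ⟨s(x, y), by simpa using h⟩

variable [AddGroup V]

theorem Edge.translate_val {e : Edge V} {x y : V} (h : e.1 = s(x, y)) (t : V) :
    (e.translate t).1 = s(x + t, y + t) :=
  congrArg (Sym2.map (· + t)) h

theorem Edge.translate_translate (e : Edge V) (s t : V) :
    (e.translate s).translate t = e.translate (s + t) :=
  Subtype.ext <| by simp [Edge.translate, Sym2.map_map, add_assoc]

theorem Edge.translate_zero (e : Edge V) : e.translate 0 = e :=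
  Subtype.ext <| by simp [Edge.translate]

end Translation

section IntegerEdges

namespace Edge

variable {e f : Edge ℤ} {i j k l : ℤ}

theorem exists_lt (e : Edge ℤ) : ∃ i j : ℤ, i < j ∧ e.1 = s(i, j) := by
  obtain ⟨⟨i, j⟩, hij⟩ := e
  rcases lt_or_gt_of_ne (show i ≠ j by simpa using hij) with h | h
  · exact ⟨i, j, h, rfl⟩
  · exact ⟨j, i, h, Sym2.eq_swap⟩

theorem length_eq_sub (h : e.1 = s(i, j)) (hij : i < j) : (e.length : ℤ) = j - i := by
  simp only [length, h, Sym2.lift_mk]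
  omega

theorem length_translate (e : Edge ℤ) (t : ℤ) : (e.translate t).length = e.length := by
  obtain ⟨i, j, hij, h⟩ := e.exists_lt
  have hlen := length_eq_sub h hij
  have hlen_translate := length_eq_sub (translate_val h t) (by omega)
  omega

theorem crosses_iff_of_lt (he : e.1 = s(i, j)) (hf : f.1 = s(k, l)) (hij : i < j) (hkl : k < l) :
    e.Crosses f ↔ i < k ∧ k < j ∧ j < l ∨ k < i ∧ i < l ∧ l < j := by
  constructor
  · rintro ⟨a, b, c, d, hab, hcd, hacb, hbda⟩
    rw [he, Sym2.eq_iff] at hab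
    rw [hf, Sym2.eq_iff] at hcd
    rw [Int.sbtw_iff] at hacb hbda
    omega
  · rintro (h | h)
    · exact ⟨i, j, k, l, he, hf, Int.sbtw_iff.2 (by omega), Int.sbtw_iff.2 (by omega)⟩
    · exact ⟨i, j, l, k, he, hf.trans Sym2.eq_swap, Int.sbtw_iff.2 (by omega),
        Int.sbtw_iff.2 (by omega)⟩

theorem Crosses.translate (h : e.Crosses f) (t : ℤ) :
    (e.translate t).Crosses (f.translate t) :=
  h.map (D := Set.univ) (fun x _ y _ z _ => by simp only [Int.sbtw_iff]; omega)
    (fun _ _ => trivial) (fun _ _ => trivial) rfl rfl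

theorem translate_crosses_iff {t : ℤ} :
    (e.translate t).Crosses f ↔ e.Crosses (f.translate (-t)) := by
  constructor <;> intro h
  · simpa [translate_translate, translate_zero] using h.translate (-t)
  · simpa [translate_translate, translate_zero] using h.translate t

theorem translate_crosses_translate_iff {s t : ℤ} :
    (e.translate s).Crosses (e.translate t) ↔ s ≠ t ∧ |t - s| < e.length := by
  obtain ⟨i, j, hij, h⟩ := e.exists_lt
  rw [crosses_iff_of_lt (translate_val h s) (translate_val h t) (by omega) (by omega),
    length_eq_sub h hij, abs_lt]
  omega

end Edge

end IntegerEdges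

section Residues

variable {N : ℕ}

theorem intCast_ne_intCast_of_lt {i j : ℤ} (hij : i < j) (hji : j < i + N) :
    (i : ZMod N) ≠ (j : ZMod N) := by
  rw [Ne, ZMod.intCast_eq_intCast_iff_dvd_sub]
  intro h
  linarith [Int.le_of_dvd (by omega) h]

variable [NeZero N]

theorem sbtw_iff_val_lt {x y z : ZMod N} : sbtw x y z ↔
    x.val < y.val ∧ y.val < z.val ∨ y.val < z.val ∧ z.val < x.val ∨
      z.val < x.val ∧ x.val < y.val := by
  cases N with
  | zero => exact absurd rfl (NeZero.ne 0)
  | succ m => exact Fin.sbtw_iff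

theorem exists_val_intCast_eq_sub (w : ℤ) : ∃ c : ℤ, ∀ i ∈ Set.Ico w (w + N),
    ((i : ZMod N).val : ℤ) = i - c ∨ ((i : ZMod N).val : ℤ) = i - c - N := by
  have hN : (0 : ℤ) < N := by exact_mod_cast NeZero.pos N
  refine ⟨N * (w / N), fun i hi => ?_⟩
  have hw := Int.mul_ediv_add_emod w N
  have hw_nonneg := Int.emod_nonneg w hN.ne'
  have hw_lt := Int.emod_lt_of_pos w hN
  have hi_emod : i % N = (i - N * (w / N)) % N := by rw [Int.sub_mul_emod_self_left]
  rw [ZMod.val_intCast, hi_emod]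
  obtain ⟨hwi, hiw⟩ := hi
  rcases lt_or_ge (i - N * (w / N)) N with h | h
  · exact Or.inl (Int.emod_eq_of_lt (by omega) h)
  · right
    rw [← Int.sub_emod_right, Int.emod_eq_of_lt (by omega) (by omega)]

theorem sbtw_intCast_iff {w i j k : ℤ} (hi : i ∈ Set.Ico w (w + N)) (hj : j ∈ Set.Ico w (w + N))
    (hk : k ∈ Set.Ico w (w + N)) : sbtw (i : ZMod N) j k ↔ sbtw i j k := by
  obtain ⟨c, hc⟩ := exists_val_intCast_eq_sub (N := N) w
  have hval := fun i : ℤ => ZMod.val_lt (i : ZMod N)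
  have := hc i hi
  have := hc j hj
  have := hc k hk
  have := hval i
  have := hval j
  have := hval k
  simp only [Set.mem_Ico] at hi hj hk
  rw [sbtw_iff_val_lt, Int.sbtw_iff]
  omega

theorem exists_intCast_eq_mem_Ico (w : ℤ) (x : ZMod N) :
    ∃ i ∈ Set.Ico w (w + N), (i : ZMod N) = x := by
  have hN : (0 : ℤ) < N := by exact_mod_cast NeZero.pos N
  obtain ⟨j, rfl⟩ := ZMod.intCast_surjective x
  refine ⟨w + (j - w) % N, ⟨?_, ?_⟩, by simp⟩
  · linarith [Int.emod_nonneg (j - w) hN.ne']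
  · linarith [Int.emod_lt_of_pos (j - w) hN]

theorem Edge.exists_eq_intCast_mem_Ico (w : ℤ) (e : Edge (ZMod N)) :
    ∃ i j : ℤ, w ≤ i ∧ i < j ∧ j < w + N ∧ e.1 = s((i : ZMod N), (j : ZMod N)) := by
  obtain ⟨⟨x, y⟩, h⟩ := e
  obtain ⟨i, hi, rfl⟩ := exists_intCast_eq_mem_Ico w x
  obtain ⟨j, hj, rfl⟩ := exists_intCast_eq_mem_Ico w y
  have hij : i ≠ j := by rintro rfl; exact h rfl
  rcases lt_or_gt_of_ne hij with hij | hji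
  · exact ⟨i, j, hi.1, hij, hj.2, rfl⟩
  · exact ⟨j, i, hj.1, hji, hi.2, Sym2.eq_swap⟩

theorem Edge.crosses_iff_of_mem_Ico {e f : Edge (ZMod N)} {w i j k l : ℤ}
    (he : e.1 = s((i : ZMod N), (j : ZMod N))) (hf : f.1 = s((k : ZMod N), (l : ZMod N)))
    (hi : w ≤ i) (hij : i < j) (hj : j < w + N) (hk : w ≤ k) (hkl : k < l) (hl : l < w + N) :
    e.Crosses f ↔ i < k ∧ k < j ∧ j < l ∨ k < i ∧ i < l ∧ l < j := by
  rw [← crosses_iff_of_lt (e := Edge.mk i j hij.ne) (f := Edge.mk k l hkl.ne) rfl rfl hij hkl]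
  have hij_mem : ∀ x ∈ (Edge.mk i j hij.ne).1, x ∈ Set.Ico w (w + N) := by
    rintro x hx
    rcases Sym2.mem_iff.1 hx with rfl | rfl <;> constructor <;> omega
  have hkl_mem : ∀ x ∈ (Edge.mk k l hkl.ne).1, x ∈ Set.Ico w (w + N) := by
    rintro x hx
    rcases Sym2.mem_iff.1 hx with rfl | rfl <;> constructor <;> omega
  exact ⟨Crosses.of_map (fun x hx y hy z hz => (sbtw_intCast_iff hx hy hz).1) hij_mem hkl_mem he hf,
    Crosses.map (fun x hx y hy z hz => (sbtw_intCast_iff hx hy hz).2) hij_mem hkl_mem he hf⟩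

end Residues

section Rotation

variable {N n : ℕ}

theorem isPeriodic_iff {S : Set (Edge (ZMod N))} :
    IsPeriodic N n S ↔ ∀ e ∈ S, ∀ k : ℤ, e.translate ((k * n : ℤ) : ZMod N) ∈ S := by
  constructor
  · intro h e he k
    induction k using Int.induction_on with
    | zero => simpa [Edge.translate_zero] using he
    | succ k ih =>
      convert (h _).1 ih using 1
      rw [Edge.translate_translate]
      push_cast
      ring_nf
    | pred k ih =>
      refine (h _).2 ?_
      convert ih using 1
      rw [Edge.translate_translate]
      push_cast
      ring_nf
  · intro h e
    refine ⟨fun he => by simpa using h e he 1, fun he => ?_⟩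
    have hback := h _ he (-1)
    rw [Edge.translate_translate] at hback
    simpa [Edge.translate_zero] using hback

theorem mem_rotationOrbit_iff [NeZero N] {S : Set (Edge (ZMod N))} {e : Edge (ZMod N)} :
    e ∈ rotationOrbit N n S ↔ ∃ f ∈ S, ∃ k : ℤ, e = f.translate ((k * n : ℤ) : ZMod N) := by
  constructor
  · rintro ⟨f, hf, l, rfl⟩
    exact ⟨f, hf, l, by push_cast; rfl⟩
  · rintro ⟨f, hf, k, rfl⟩
    exact ⟨f, hf, (k : ZMod N).val, by push_cast; rw [ZMod.natCast_zmod_val]⟩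

end Rotation

section Lifts

variable {N : ℕ}

/-- The edge `g` of the universal cover reduces modulo `N` to the edge `e` of the `N`-gon, so that
`reduceMod N S` is the set of the edges that have a lift in `S`. -/
def Edge.IsLift (g : Edge ℤ) (e : Edge (ZMod N)) : Prop :=
  e.1 = g.1.map (fun i : ℤ => (i : ZMod N))

namespace Edge

variable {g h : Edge ℤ} {e f : Edge (ZMod N)} {i j : ℤ}

theorem IsLift.unique (hge : g.IsLift e) (hgf : g.IsLift f) : e = f :=
  Subtype.ext (hge.trans hgf.symm)

theorem IsLift.val_eq (hge : g.IsLift e) (hg : g.1 = s(i, j)) :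
    e.1 = s((i : ZMod N), (j : ZMod N)) := by
  rw [hge, hg, Sym2.map_mk]

theorem IsLift.translate (hge : g.IsLift e) (t : ℤ) :
    (g.translate t).IsLift (e.translate (t : ZMod N)) := by
  obtain ⟨i, j, -, hg⟩ := g.exists_lt
  rw [IsLift, translate_val hg, translate_val (hge.val_eq hg), Sym2.map_mk, Int.cast_add,
    Int.cast_add]

theorem exists_isLift_of_length_le (hg : 2 * g.length ≤ N) : ∃ e : Edge (ZMod N), g.IsLift e := by
  obtain ⟨i, j, hij, hval⟩ := g.exists_lt
  have hlen := length_eq_sub hval hij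
  refine ⟨Edge.mk i j (intCast_ne_intCast_of_lt hij (by omega)), ?_⟩
  rw [IsLift, hval]
  rfl

theorem exists_isLift [NeZero N] (e : Edge (ZMod N)) :
    ∃ g : Edge ℤ, g.IsLift e ∧ 2 * g.length ≤ N := by
  obtain ⟨i, j, hi, hij, hj, he⟩ := e.exists_eq_intCast_mem_Ico 0
  rcases le_or_gt (2 * (j - i)) N with hle | hlt
  · refine ⟨Edge.mk i j hij.ne, he, ?_⟩
    have hlen := length_eq_sub (e := Edge.mk i j hij.ne) rfl hij
    omega
  · have hji : j < i + N := by omega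
    refine ⟨Edge.mk j (i + N) hji.ne, ?_, ?_⟩
    · rw [IsLift, he, Edge.mk, Sym2.map_mk, Int.cast_add, Int.cast_natCast, ZMod.natCast_self,
        add_zero]
      exact Sym2.eq_swap
    · have hlen := length_eq_sub (e := Edge.mk j (i + N) hji.ne) rfl hji
      omega

/-- Two short lifts of `e` may differ by half a turn of the `N`-gon, but only if `e` is a
diameter. -/
theorem IsLift.exists_eq_translate {m : ℕ} (hN : N = 2 * m) (hge : g.IsLift e) (hhe : h.IsLift e)
    (hg : g.length ≤ m) (hh : h.length ≤ m) : ∃ k : ℤ, h = g.translate (k * m) := by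
  obtain ⟨i, j, hij, hgij⟩ := g.exists_lt
  obtain ⟨k, l, hkl, hhkl⟩ := h.exists_lt
  have hji : j - i ≤ m := by rw [← length_eq_sub hgij hij]; exact_mod_cast hg
  have hlk : l - k ≤ m := by rw [← length_eq_sub hhkl hkl]; exact_mod_cast hh
  have hval := (hge.val_eq hgij).symm.trans (hhe.val_eq hhkl)
  simp only [Sym2.eq_iff, ZMod.intCast_eq_intCast_iff_dvd_sub, hN] at hval
  push_cast at hval
  have hm : (0 : ℤ) < m := by omega
  rcases hval with ⟨⟨p, hp⟩, ⟨q, hq⟩⟩ | ⟨⟨q, hq⟩, ⟨p, hp⟩⟩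
  · have hpq : p = q := by
      have hlt : p < q + 1 := lt_of_mul_lt_mul_left (a := 2 * (m : ℤ)) (by linarith) (by omega)
      have hgt : q < p + 1 := lt_of_mul_lt_mul_left (a := 2 * (m : ℤ)) (by linarith) (by omega)
      omega
    refine ⟨2 * p, Subtype.ext ?_⟩
    rw [hhkl, translate_val hgij]
    congr 2 <;> subst hpq <;> linarith
  · have hpq : q = p + 1 := by
      have hlt : q < p + 2 := lt_of_mul_lt_mul_left (a := 2 * (m : ℤ)) (by linarith) (by omega)
      have hgt : p < q := lt_of_mul_lt_mul_left (a := 2 * (m : ℤ)) (by linarith) (by omega)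
      omega
    subst hpq
    refine ⟨2 * p + 1, Subtype.ext ?_⟩
    rw [hhkl, translate_val hgij]
    congr 2 <;> linarith

theorem Crosses.of_isLift [NeZero N] (hgh : g.Crosses h) (hge : g.IsLift e) (hhf : h.IsLift f)
    (hg : 2 * g.length ≤ N) (hh : 2 * h.length ≤ N) : e.Crosses f := by
  obtain ⟨i, j, hij, hgij⟩ := g.exists_lt
  obtain ⟨k, l, hkl, hhkl⟩ := h.exists_lt
  have hglen := length_eq_sub hgij hij
  have hhlen := length_eq_sub hhkl hkl
  rw [crosses_iff_of_lt hgij hhkl hij hkl] at hgh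
  exact (crosses_iff_of_mem_Ico (w := min i k) (hge.val_eq hgij) (hhf.val_eq hhkl) (by omega) hij
    (by omega) (by omega) hkl (by omega)).2 hgh

end Edge

theorem IsCrossing.reduceMod [NeZero N] {k : ℕ} {C : Set (Edge ℤ)} (hC : IsCrossing k C)
    (hlen : ∀ g ∈ C, 2 * g.length ≤ N) : IsCrossing k (reduceMod N C) := by
  choose r hr using fun g : C => Edge.exists_isLift_of_length_le (hlen g g.2)
  have hcross (g h : C) (hne : g ≠ h) : (r g).Crosses (r h) :=
    (hC.2 g.2 h.2 (Subtype.coe_ne_coe.2 hne)).of_isLift (hr g) (hr h) (hlen g g.2) (hlen h h.2)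
  have hinj : Function.Injective r := fun g h hgh => by
    by_contra hne
    exact (hcross g h hne).ne hgh
  have hrange : HalfCylinder.reduceMod N C = Set.range r := by
    ext e
    constructor
    · rintro ⟨g, hg, hge⟩
      exact ⟨⟨g, hg⟩, (hr ⟨g, hg⟩).unique hge⟩
    · rintro ⟨g, rfl⟩
      exact ⟨g, g.2, hr g⟩
  rw [hrange]
  constructor
  · rw [← Set.image_univ, hinj.encard_image, Set.encard_univ, ENat.card_coe_set_eq, hC.1]
  · rintro _ ⟨g, rfl⟩ _ ⟨h, rfl⟩ hne
    exact hcross g h (ne_of_apply_ne r hne)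

end Lifts

section Cylinder

variable {n : ℕ}

theorem proj_eq_proj_iff {g h : Edge ℤ} :
    proj n g = proj n h ↔ ∃ k : ℤ, h = g.translate (k * n) :=
  Quotient.eq (r := deckSetoid n)

theorem proj_translate (g : Edge ℤ) (k : ℤ) : proj n (g.translate (k * n)) = proj n g :=
  (proj_eq_proj_iff.2 ⟨k, rfl⟩).symm

theorem proj_mk_add_two_mul {i j : ℤ} (hij : i ≠ j) :
    proj n (Edge.mk (i + 2 * n) (j + 2 * n) (by omega)) = proj n (Edge.mk i j hij) :=
  proj_translate (Edge.mk i j hij) 2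

theorem translate_mem_lift_iff {E : Set (CylinderEdge n)} {g : Edge ℤ} (k : ℤ) :
    g.translate (k * n) ∈ lift n E ↔ g ∈ lift n E := by
  rw [lift, Set.mem_preimage, proj_translate, Set.mem_preimage]

theorem isPeriodic_toPolygon (E : Set (CylinderEdge n)) :
    IsPeriodic (4 * n) n (toPolygon n E) := by
  rw [isPeriodic_iff]
  rintro e ⟨g, hg, hge⟩ k
  exact ⟨_, (translate_mem_lift_iff k).2 hg, Edge.IsLift.translate hge _⟩

theorem exists_mem_toPolygon_isLift {E : Set (CylinderEdge n)} (hE : LengthLE n (2 * n) E)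
    {g : Edge ℤ} (hg : g ∈ lift n E) : ∃ e ∈ toPolygon n E, g.IsLift e := by
  have hlen := hE g hg
  obtain ⟨e, hge⟩ := Edge.exists_isLift_of_length_le (N := 4 * n) (g := g) (by omega)
  exact ⟨e, ⟨g, hg, hge⟩, hge⟩

theorem mem_lift_insert_iff {E : Set (CylinderEdge n)} {g h : Edge ℤ} :
    h ∈ lift n (insert (proj n g) E) ↔ (∃ k : ℤ, h = g.translate (k * n)) ∨ h ∈ lift n E := by
  rw [lift, Set.mem_preimage, Set.mem_insert_iff, eq_comm, proj_eq_proj_iff]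
  rfl

theorem lengthLE_image_proj {C : Set (Edge ℤ)} {L : ℕ} (hC : ∀ g ∈ C, g.length ≤ L) :
    LengthLE n L (proj n '' C) := by
  rintro g ⟨h, hh, hgh⟩
  obtain ⟨k, rfl⟩ := proj_eq_proj_iff.1 hgh
  rw [Edge.length_translate]
  exact hC h hh

variable [NeZero n]

theorem exists_isLift_length_le (e : Edge (ZMod (4 * n))) :
    ∃ g : Edge ℤ, g.IsLift e ∧ g.length ≤ 2 * n := by
  obtain ⟨g, hge, hg⟩ := e.exists_isLift
  exact ⟨g, hge, by omega⟩

/-- The edge of `C_n` covered by the lifts of length at most `2n` of an edge of the `4n`-gon: the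
quotient map of the `4n`-gon by the rotation by `π / 2`. The lift is unique up to deck
transformations, see `toCylinder_eq_of_isLift`. -/
noncomputable def toCylinder (e : Edge (ZMod (4 * n))) : CylinderEdge n :=
  proj n (exists_isLift_length_le e).choose

variable {e f : Edge (ZMod (4 * n))} {g : Edge ℤ} {E : Set (CylinderEdge n)}
  {S : Set (Edge (ZMod (4 * n)))}

theorem exists_isLift_proj_eq (e : Edge (ZMod (4 * n))) :
    ∃ g : Edge ℤ, g.IsLift e ∧ g.length ≤ 2 * n ∧ proj n g = toCylinder e :=
  have h := (exists_isLift_length_le e).choose_spec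
  ⟨_, h.1, h.2, rfl⟩

theorem toCylinder_eq_of_isLift (hge : g.IsLift e) (hg : g.length ≤ 2 * n) :
    toCylinder e = proj n g := by
  obtain ⟨h, hhe, hh, hproj⟩ := exists_isLift_proj_eq e
  obtain ⟨k, rfl⟩ := hge.exists_eq_translate (by ring) hhe hg hh
  rw [← hproj, ← proj_translate g (k * 2)]
  push_cast
  ring_nf

theorem toCylinder_eq_iff :
    toCylinder e = toCylinder f ↔ ∃ k : ℤ, f = e.translate ((k * n : ℤ) : ZMod (4 * n)) := by
  obtain ⟨g, hge, hg, hproj⟩ := exists_isLift_proj_eq e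
  constructor
  · intro hef
    obtain ⟨h, hhf, -, hproj'⟩ := exists_isLift_proj_eq f
    obtain ⟨k, rfl⟩ := proj_eq_proj_iff.1 (hproj.trans (hef.trans hproj'.symm))
    exact ⟨k, hhf.unique (hge.translate _)⟩
  · rintro ⟨k, rfl⟩
    rw [toCylinder_eq_of_isLift (hge.translate _) (by rwa [Edge.length_translate]), proj_translate,
      hproj]

theorem toPolygon_eq_preimage (hE : LengthLE n (2 * n) E) : toPolygon n E = toCylinder ⁻¹' E := by
  ext e
  constructor
  · rintro ⟨g, hg, hge⟩
    rw [Set.mem_preimage, toCylinder_eq_of_isLift hge (hE g hg)]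
    exact hg
  · intro he
    obtain ⟨g, hge, -, hproj⟩ := exists_isLift_proj_eq e
    exact ⟨g, by rwa [lift, Set.mem_preimage, hproj], hge⟩

theorem LengthLE.subset_range (hE : LengthLE n (2 * n) E) : E ⊆ Set.range toCylinder := by
  intro x hx
  obtain ⟨g, rfl⟩ : ∃ g, proj n g = x := Quotient.exists_rep x
  obtain ⟨e, -, hge⟩ := exists_mem_toPolygon_isLift hE hx
  exact ⟨e, toCylinder_eq_of_isLift hge (hE g hx)⟩

theorem toPolygon_subset_toPolygon_iff {F : Set (CylinderEdge n)} (hE : LengthLE n (2 * n) E)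
    (hF : LengthLE n (2 * n) F) : toPolygon n E ⊆ toPolygon n F ↔ E ⊆ F := by
  rw [toPolygon_eq_preimage hE, toPolygon_eq_preimage hF,
    Set.preimage_subset_preimage_iff hE.subset_range]

theorem lengthLE_image_toCylinder (S : Set (Edge (ZMod (4 * n)))) :
    LengthLE n (2 * n) (toCylinder '' S) := by
  choose g _ hg hproj using exists_isLift_proj_eq (n := n)
  rw [← funext hproj, ← Function.comp_def, Set.image_comp]
  exact lengthLE_image_proj (by rintro _ ⟨e, -, rfl⟩; exact hg e)

theorem rotationOrbit_eq_preimage_image (S : Set (Edge (ZMod (4 * n)))) :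
    rotationOrbit (4 * n) n S = toCylinder ⁻¹' (toCylinder '' S) := by
  ext e
  simp only [mem_rotationOrbit_iff, Set.mem_preimage, Set.mem_image, toCylinder_eq_iff]

theorem IsPeriodic.preimage_image_toCylinder (hS : IsPeriodic (4 * n) n S) :
    toCylinder ⁻¹' (toCylinder '' S) = S := by
  refine Set.Subset.antisymm ?_ (Set.subset_preimage_image _ S)
  rintro e ⟨f, hf, hfe⟩
  obtain ⟨k, rfl⟩ := toCylinder_eq_iff.1 hfe
  exact isPeriodic_iff.1 hS f hf k

theorem bijOn_toPolygon_lengthLE :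
    Set.BijOn (toPolygon n) {E | LengthLE n (2 * n) E} {S | IsPeriodic (4 * n) n S} := by
  refine ⟨fun E _ => ?_, fun E hE F hF hEF => ?_, fun S hS => ?_⟩
  · exact isPeriodic_toPolygon E
  · exact Set.Subset.antisymm ((toPolygon_subset_toPolygon_iff hE hF).1 hEF.subset)
      ((toPolygon_subset_toPolygon_iff hF hE).1 hEF.superset)
  · refine ⟨toCylinder '' S, lengthLE_image_toCylinder S, ?_⟩
    rw [toPolygon_eq_preimage (lengthLE_image_toCylinder S)]
    exact IsPeriodic.preimage_image_toCylinder hS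

theorem toCylinder_image_reduceMod {C : Set (Edge ℤ)} (hC : ∀ g ∈ C, g.length ≤ 2 * n) :
    toCylinder '' reduceMod (4 * n) C = proj n '' C := by
  ext x
  constructor
  · rintro ⟨e, ⟨g, hg, hge⟩, rfl⟩
    exact ⟨g, hg, (toCylinder_eq_of_isLift hge (hC g hg)).symm⟩
  · rintro ⟨g, hg, rfl⟩
    have hglen := hC g hg
    obtain ⟨e, hge⟩ := Edge.exists_isLift_of_length_le (N := 4 * n) (g := g) (by omega)
    exact ⟨e, ⟨g, hg, hge⟩, toCylinder_eq_of_isLift hge hglen⟩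

end Cylinder

section Hexagons

/-- The integers `a < b < ⋯ < f` lie in a window of length `N`, so that they represent six
consecutive corners of a hexagon inscribed in the `N`-gon, with long diagonals `[a, d]`, `[b, e]`
and `[c, f]`. -/
abbrev IsHexagon (N : ℕ) (a b c d e f : ℤ) : Prop :=
  a < b ∧ b < c ∧ c < d ∧ d < e ∧ e < f ∧ f < a + N

variable {N : ℕ} [NeZero N] {a b c d e f : ℤ} {g₁ g₂ g₃ : Edge (ZMod N)}

theorem IsHexagon.crosses (h : IsHexagon N a b c d e f)
    (h₁ : g₁.1 = s((a : ZMod N), (d : ZMod N))) (h₂ : g₂.1 = s((b : ZMod N), (e : ZMod N)))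
    (h₃ : g₃.1 = s((c : ZMod N), (f : ZMod N))) :
    g₁.Crosses g₂ ∧ g₁.Crosses g₃ ∧ g₂.Crosses g₃ := by
  rw [Edge.crosses_iff_of_mem_Ico (w := a) h₁ h₂, Edge.crosses_iff_of_mem_Ico (w := a) h₁ h₃,
    Edge.crosses_iff_of_mem_Ico (w := a) h₂ h₃] <;> omega

theorem exists_isHexagon_of_crosses (had : a < d) (hda : d < a + N)
    (h₁ : g₁.1 = s((a : ZMod N), (d : ZMod N)))
    (h₁₂ : g₁.Crosses g₂) (h₁₃ : g₁.Crosses g₃) (h₂₃ : g₂.Crosses g₃) :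
    ∃ b c e f : ℤ, IsHexagon N a b c d e f ∧
      (g₂.1 = s((b : ZMod N), (e : ZMod N)) ∧ g₃.1 = s((c : ZMod N), (f : ZMod N)) ∨
        g₃.1 = s((b : ZMod N), (e : ZMod N)) ∧ g₂.1 = s((c : ZMod N), (f : ZMod N))) := by
  obtain ⟨b, e, hab, hbe, hea, h₂⟩ := g₂.exists_eq_intCast_mem_Ico a
  obtain ⟨c, f, hac, hcf, hfa, h₃⟩ := g₃.exists_eq_intCast_mem_Ico a
  rw [Edge.crosses_iff_of_mem_Ico (w := a) h₁ h₂ le_rfl had hda hab hbe hea] at h₁₂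
  rw [Edge.crosses_iff_of_mem_Ico (w := a) h₁ h₃ le_rfl had hda hac hcf hfa] at h₁₃
  rw [Edge.crosses_iff_of_mem_Ico (w := a) h₂ h₃ hab hbe hea hac hcf hfa] at h₂₃
  rcases lt_or_ge b c with hbc | hcb
  · exact ⟨b, c, e, f, by omega, Or.inl ⟨h₂, h₃⟩⟩
  · exact ⟨c, b, f, e, by omega, Or.inr ⟨h₃, h₂⟩⟩

end Hexagons

section CrossingLifts

variable {n : ℕ} [NeZero n]

theorem toCylinder_eq_proj_of_le {x : Edge (ZMod (4 * n))} {i j : ℤ}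
    (hx : x.1 = s((i : ZMod (4 * n)), (j : ZMod (4 * n)))) (hij : i < j) (hji : j ≤ i + 2 * n) :
    toCylinder x = proj n (Edge.mk i j hij.ne) := by
  have hlen := Edge.length_eq_sub (e := Edge.mk i j hij.ne) rfl hij
  exact toCylinder_eq_of_isLift hx (by omega)

theorem toCylinder_eq_proj_of_ge {x : Edge (ZMod (4 * n))} {i j : ℤ}
    (hx : x.1 = s((i : ZMod (4 * n)), (j : ZMod (4 * n)))) (hij : i + 2 * n ≤ j)
    (hji : j - 4 * n < i) : toCylinder x = proj n (Edge.mk (j - 4 * n) i hji.ne) := by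
  refine toCylinder_eq_proj_of_le ?_ hji (by omega)
  have hN : ((4 * n : ℤ) : ZMod (4 * n)) = 0 := by exact_mod_cast ZMod.natCast_self (4 * n)
  rw [hx, Int.cast_sub, hN, sub_zero, Sym2.eq_swap]

/-- A diagonal longer than `2n` is replaced by its complementary lift. If only `[b, e]` is long,
that lift has to be rotated by a half turn in order to cross the other two. -/
theorem IsHexagon.exists_crossing_lifts {a b c d e f : ℤ} (h : IsHexagon (4 * n) a b c d e f)
    (hda : d ≤ a + 2 * n) {x₁ x₂ x₃ : Edge (ZMod (4 * n))}
    (h₁ : x₁.1 = s((a : ZMod (4 * n)), (d : ZMod (4 * n))))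
    (h₂ : x₂.1 = s((b : ZMod (4 * n)), (e : ZMod (4 * n))))
    (h₃ : x₃.1 = s((c : ZMod (4 * n)), (f : ZMod (4 * n)))) :
    ∃ g₁ g₂ g₃ : Edge ℤ, g₁.Crosses g₂ ∧ g₁.Crosses g₃ ∧ g₂.Crosses g₃ ∧
      toCylinder x₁ = proj n g₁ ∧ toCylinder x₂ = proj n g₂ ∧ toCylinder x₃ = proj n g₃ := by
  obtain ⟨hab, hbc, hcd, hde, hef, hfa⟩ := h
  push_cast at hfa
  have crosses {i j k l : ℤ} (hij : i < j) (hkl : k < l)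
      (h : i < k ∧ k < j ∧ j < l ∨ k < i ∧ i < l ∧ l < j) :
      (Edge.mk i j hij.ne).Crosses (Edge.mk k l hkl.ne) :=
    (Edge.crosses_iff_of_lt rfl rfl hij hkl).2 h
  have had : a < d := by omega
  have hbe : b < e := by omega
  have hcf : c < f := by omega
  have heb : e - 4 * n < b := by omega
  have hfc : f - 4 * n < c := by omega
  have hx₁ := toCylinder_eq_proj_of_le h₁ had hda
  rcases le_total e (b + 2 * n) with hb | hb <;> rcases le_total f (c + 2 * n) with hc | hc
  · exact ⟨_, _, _, crosses had hbe (by omega), crosses had hcf (by omega),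
      crosses hbe hcf (by omega), hx₁, toCylinder_eq_proj_of_le h₂ hbe hb,
      toCylinder_eq_proj_of_le h₃ hcf hc⟩
  · exact ⟨_, _, _, crosses had hbe (by omega), crosses had hfc (by omega),
      crosses hbe hfc (by omega), hx₁, toCylinder_eq_proj_of_le h₂ hbe hb,
      toCylinder_eq_proj_of_ge h₃ hc hfc⟩
  · have heb' : e - 4 * n + 2 * n < b + 2 * n := by omega
    refine ⟨_, _, _, crosses had heb' (by omega), crosses had hcf (by omega),
      crosses heb' hcf (by omega), hx₁, ?_, toCylinder_eq_proj_of_le h₃ hcf hc⟩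
    rw [toCylinder_eq_proj_of_ge h₂ hb heb, proj_mk_add_two_mul heb.ne]
  · exact ⟨_, _, _, crosses had heb (by omega), crosses had hfc (by omega),
      crosses heb hfc (by omega), hx₁, toCylinder_eq_proj_of_ge h₂ hb heb,
      toCylinder_eq_proj_of_ge h₃ hc hfc⟩

theorem exists_crossing_lifts {x₁ x₂ x₃ : Edge (ZMod (4 * n))} (h₁₂ : x₁.Crosses x₂)
    (h₁₃ : x₁.Crosses x₃) (h₂₃ : x₂.Crosses x₃) :
    ∃ g₁ g₂ g₃ : Edge ℤ, g₁.Crosses g₂ ∧ g₁.Crosses g₃ ∧ g₂.Crosses g₃ ∧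
      toCylinder x₁ = proj n g₁ ∧ toCylinder x₂ = proj n g₂ ∧ toCylinder x₃ = proj n g₃ := by
  obtain ⟨g, hgx, hg⟩ := exists_isLift_length_le x₁
  obtain ⟨a, d, had, hval⟩ := g.exists_lt
  have hlen := Edge.length_eq_sub hval had
  have h₁ := hgx.val_eq hval
  obtain ⟨b, c, e, f, hexagon, ⟨h₂, h₃⟩ | ⟨h₃, h₂⟩⟩ :=
    exists_isHexagon_of_crosses had (by omega) h₁ h₁₂ h₁₃ h₂₃
  · exact hexagon.exists_crossing_lifts (by omega) h₁ h₂ h₃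
  · obtain ⟨g₁, g₃, g₂, h₁₃, h₁₂, h₃₂, hx₁, hx₃, hx₂⟩ :=
      hexagon.exists_crossing_lifts (by omega) h₁ h₃ h₂
    exact ⟨g₁, g₂, g₃, h₁₂, h₁₃, h₃₂.symm, hx₁, hx₂, hx₃⟩

theorem isCylinderCrossing_iff {E : Set (CylinderEdge n)} (hE : LengthLE n (2 * n) E) :
    IsCylinderCrossing n 3 E ↔
      ∃ C, IsCrossing 3 C ∧ toPolygon n E = rotationOrbit (4 * n) n C := by
  have hiff (C : Set (Edge (ZMod (4 * n)))) :
      toPolygon n E = rotationOrbit (4 * n) n C ↔ toCylinder '' C = E := by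
    rw [toPolygon_eq_preimage hE, rotationOrbit_eq_preimage_image,
      Set.preimage_eq_preimage' hE.subset_range (Set.image_subset_range _ _), eq_comm]
  simp only [hiff]
  constructor
  · rintro ⟨C, hC, rfl⟩
    have hlen : ∀ g ∈ C, g.length ≤ 2 * n := fun g hg => hE g ⟨g, hg, rfl⟩
    exact ⟨_, hC.reduceMod fun g hg => by linarith [hlen g hg], toCylinder_image_reduceMod hlen⟩
  · rintro ⟨C, hC, rfl⟩
    obtain ⟨x₁, x₂, x₃, rfl, h₁₂, h₁₃, h₂₃⟩ := isCrossing_three_iff.1 hC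
    obtain ⟨g₁, g₂, g₃, hg₁₂, hg₁₃, hg₂₃, hx₁, hx₂, hx₃⟩ := exists_crossing_lifts h₁₂ h₁₃ h₂₃
    refine ⟨{g₁, g₂, g₃}, isCrossing_three_iff.2 ⟨g₁, g₂, g₃, rfl, hg₁₂, hg₁₃, hg₂₃⟩, ?_⟩
    simp only [Set.image_insert_eq, Set.image_singleton, hx₁, hx₂, hx₃]

theorem crossingFree_lift_iff {E : Set (CylinderEdge n)} (hE : LengthLE n (2 * n) E) :
    CrossingFree 3 (lift n E) ↔ CrossingFree 3 (toPolygon n E) := by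
  constructor
  · rw [toPolygon_eq_preimage hE]
    simp only [crossingFree_three_iff]
    intro h x₁ hx₁ x₂ hx₂ x₃ hx₃ h₁₂ h₁₃ h₂₃
    obtain ⟨g₁, g₂, g₃, hg₁₂, hg₁₃, hg₂₃, hxg₁, hxg₂, hxg₃⟩ := exists_crossing_lifts h₁₂ h₁₃ h₂₃
    rw [Set.mem_preimage, hxg₁] at hx₁
    rw [Set.mem_preimage, hxg₂] at hx₂
    rw [Set.mem_preimage, hxg₃] at hx₃
    exact h g₁ hx₁ g₂ hx₂ g₃ hx₃ hg₁₂ hg₁₃ hg₂₃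
  · intro h C hCE hC
    refine h (reduceMod (4 * n) C) ?_ (hC.reduceMod fun g hg => by linarith [hE g (hCE hg)])
    rintro e ⟨g, hg, hge⟩
    exact ⟨g, hCE hg, hge⟩

end CrossingLifts

section Blocking

variable {n : ℕ} {S : Set (Edge (ZMod (4 * n)))}

/-- The vertices of the `4n`-gon with integer representatives `i` and `j` are joined by an edge
of `S`. -/
def Joins (S : Set (Edge (ZMod (4 * n)))) (i j : ℤ) : Prop :=
  ∃ e ∈ S, e.1 = s((i : ZMod (4 * n)), (j : ZMod (4 * n)))

/-- The diagonal `[a, d]` is blocked if adding it to `S` would create a `3`-crossing. Integer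
representatives are required to satisfy `a < d < a + 4n`. -/
def Blocked (S : Set (Edge (ZMod (4 * n)))) (a d : ℤ) : Prop :=
  ∃ b c e f, IsHexagon (4 * n) a b c d e f ∧ Joins S b e ∧ Joins S c f

/-- The diagonal `[x, y]` lies between the crossing diagonals `[a, d]` and `[a + n, d + n]` and
crosses both of them. -/
abbrev Straddles (n : ℕ) (a d x y : ℤ) : Prop :=
  a < x ∧ x < a + n ∧ a + n < d ∧ d < y ∧ y < d + n

variable {a d x y i j i' j' : ℤ}

theorem Joins.shift (hS : IsPeriodic (4 * n) n S) (h : Joins S i j) (k : ℤ) (hi : i' = i + k * n)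
    (hj : j' = j + k * n) : Joins S i' j' := by
  obtain ⟨e, he, hval⟩ := h
  refine ⟨_, isPeriodic_iff.1 hS e he k, ?_⟩
  rw [Edge.translate_val hval, hi, hj, Int.cast_add, Int.cast_add]

theorem Joins.wrap (hS : IsPeriodic (4 * n) n S) (h : Joins S i j) (k : ℤ) (hi : i' = j + k * n)
    (hj : j' = i + (k + 4) * n) : Joins S i' j' := by
  obtain ⟨e, he, hval⟩ := h.shift hS k rfl hi
  refine ⟨e, he, ?_⟩
  have hN : ((4 * n : ℤ) : ZMod (4 * n)) = 0 := by exact_mod_cast ZMod.natCast_self (4 * n)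
  rw [hval, hj, add_mul, ← add_assoc, Int.cast_add _ (4 * n : ℤ), hN, add_zero, Sym2.eq_swap]

theorem Blocked.of_add (hS : IsPeriodic (4 * n) n S) (h : Blocked S (a + n) (d + n)) :
    Blocked S a d := by
  obtain ⟨b, c, e, f, hexagon, hbe, hcf⟩ := h
  exact ⟨b - n, c - n, e - n, f - n, by omega, hbe.shift hS (-1) (by ring) (by ring),
    hcf.shift hS (-1) (by ring) (by ring)⟩

theorem Straddles.le_add (hS : IsPeriodic (4 * n) n S) (h : Straddles n a d x y)
    (hda : d ≤ a + 2 * n) (hB : ¬ Blocked S a d) (hxy : Joins S x y) : y ≤ x + n := by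
  by_contra! hlt
  exact hB ⟨x, y - n, y, x + 3 * n, by omega, hxy, hxy.wrap hS (-1) (by ring) (by ring)⟩

theorem exists_longest_straddles (hS : IsPeriodic (4 * n) n S) (hda : d ≤ a + 2 * n)
    (hB : ¬ Blocked S a d) (h : ∃ x y, Joins S x y ∧ Straddles n a d x y) :
    ∃ x y, Joins S x y ∧ Straddles n a d x y ∧
      ∀ x' y', Joins S x' y' → Straddles n a d x' y' → y' - x' ≤ y - x := by
  obtain ⟨x₀, y₀, hxy₀, hst₀⟩ := h
  obtain ⟨_, ⟨x, y, hxy, hst, rfl⟩, hmax⟩ := Int.exists_greatest_of_bdd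
    (P := fun l => ∃ x y, Joins S x y ∧ Straddles n a d x y ∧ l = y - x)
    ⟨n, by rintro _ ⟨x, y, hxy, hst, rfl⟩; linarith [hst.le_add hS hda hB hxy]⟩
    ⟨y₀ - x₀, x₀, y₀, hxy₀, hst₀, rfl⟩
  exact ⟨x, y, hxy, hst, fun x' y' hxy' hst' => hmax _ ⟨x', y', hxy', hst', rfl⟩⟩

theorem straddles_of_crosses (hS : IsPeriodic (4 * n) n S) {g h : Edge ℤ} (hg : g.1 = s(a, d))
    (hh : h.1 = s(x, y)) (had : a < d) (hda : d ≤ a + 2 * n) (hxy : x < y) (hyx : y ≤ x + 2 * n)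
    (hB : ¬ Blocked S a d) (hJ : Joins S x y) (hgg : g.Crosses (g.translate n))
    (hgh : g.Crosses h) (hgh' : (g.translate n).Crosses h) : Straddles n a d x y := by
  rw [Edge.crosses_iff_of_lt hg (Edge.translate_val hg n) had (by omega)] at hgg
  rw [Edge.crosses_iff_of_lt hg hh had hxy] at hgh
  rw [Edge.crosses_iff_of_lt (Edge.translate_val hg n) hh (by omega) hxy] at hgh'
  rcases lt_or_ge x a with hxa | hax
  · exact absurd ⟨x + n, y, y + n, x + 4 * n, by omega, hJ.shift hS 1 (by ring) (by ring),
      hJ.wrap hS 0 (by ring) (by ring)⟩ hB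
  rcases lt_or_ge (a + n) x with hax' | hxa'
  · exact absurd ⟨x - n, x, y - n, y, by omega, hJ.shift hS (-1) (by ring) (by ring), hJ⟩ hB
  · omega

variable [NeZero n]

theorem Blocked.exists_crosses (h : Blocked S a d) {e : Edge (ZMod (4 * n))}
    (he : e.1 = s((a : ZMod (4 * n)), (d : ZMod (4 * n)))) :
    ∃ f ∈ S, ∃ g ∈ S, e.Crosses f ∧ e.Crosses g ∧ f.Crosses g := by
  obtain ⟨_, _, _, _, hexagon, ⟨f, hf, hbe⟩, ⟨g, hg, hcf⟩⟩ := h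
  exact ⟨f, hf, g, hg, hexagon.crosses he hbe hcf⟩

theorem blocked_of_crosses (had : a < d) (hda : d < a + 4 * n) {e f g : Edge (ZMod (4 * n))}
    (he : e.1 = s((a : ZMod (4 * n)), (d : ZMod (4 * n)))) (hf : f ∈ S) (hg : g ∈ S)
    (hef : e.Crosses f) (heg : e.Crosses g) (hfg : f.Crosses g) : Blocked S a d := by
  obtain ⟨_, _, _, _, hexagon, ⟨hf', hg'⟩ | ⟨hg', hf'⟩⟩ :=
    exists_isHexagon_of_crosses had (by omega) he hef heg hfg
  · exact ⟨_, _, _, _, hexagon, ⟨f, hf, hf'⟩, ⟨g, hg, hg'⟩⟩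
  · exact ⟨_, _, _, _, hexagon, ⟨g, hg, hg'⟩, ⟨f, hf, hf'⟩⟩

theorem CrossingFree.not_blocked (hS : CrossingFree 3 S) (h : Joins S a d) : ¬ Blocked S a d := by
  obtain ⟨e, he, hval⟩ := h
  intro hB
  obtain ⟨f, hf, g, hg, hef, heg, hfg⟩ := hB.exists_crosses hval
  exact crossingFree_three_iff.1 hS e he f hf g hg hef heg hfg

theorem not_blocked_of_longest_left (hS : IsPeriodic (4 * n) n S) (hfree : CrossingFree 3 S)
    (hB : ¬ Blocked S a d) (hxy : Joins S x y) (hst : Straddles n a d x y)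
    (hmax : ∀ x' y', Joins S x' y' → Straddles n a d x' y' → y' - x' ≤ y - x) :
    ¬ Blocked S a y := by
  rintro ⟨b, c, e, f, hexagon, hbe, hcf⟩
  rcases lt_or_ge c d with hcd | hdc
  · exact hB ⟨b, c, e, f, by omega, hbe, hcf⟩
  rcases lt_or_ge x b with hxb | hbx
  · exact hfree.not_blocked hxy ⟨b, c, e, f, by omega, hbe, hcf⟩
  rcases lt_or_ge e (d + n) with hed | hde
  · have := hmax b e hbe (by omega)
    omega
  · exact hB <| Blocked.of_add hS
      ⟨c, y, f, x + 4 * n, by omega, hcf, hxy.wrap hS 0 (by ring) (by ring)⟩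

theorem not_blocked_of_longest_right (hS : IsPeriodic (4 * n) n S) (hfree : CrossingFree 3 S)
    (hB : ¬ Blocked S a d) (hxy : Joins S x y) (hst : Straddles n a d x y)
    (hmax : ∀ x' y', Joins S x' y' → Straddles n a d x' y' → y' - x' ≤ y - x) :
    ¬ Blocked S x (d + n) := by
  rintro ⟨b, c, e, f, hexagon, hbe, hcf⟩
  rcases lt_or_ge (a + n) b with hab | hba
  · exact hB <| Blocked.of_add hS ⟨b, c, e, f, by omega, hbe, hcf⟩
  rcases lt_or_ge c y with hcy | hyc
  · exact hfree.not_blocked hxy ⟨b, c, e, f, by omega, hbe, hcf⟩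
  rcases lt_or_ge (a + 4 * n) f with haf | hfa
  · have := hmax (f - 4 * n) c (hcf.wrap hS (-4) (by ring) (by ring)) (by omega)
    omega
  · exact hB ⟨x, b, y, e, by omega, hxy, hbe⟩

/-- Descending induction on `d - a`. If `[a, d]` is not blocked, then neither are the longer
diagonals `[a, y]` and `[x, d + n]`, where `[x, y]` is a longest straddling diagonal. Hence both
belong to `S`, and they form a `3`-crossing with the rotation `[a + n, y + n]` of `[a, y]`. -/
theorem blocked_of_forall_exists_straddles {a d : ℤ} (hS : IsPeriodic (4 * n) n S)
    (hfree : CrossingFree 3 S)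
    (hstraddle : ∀ a d : ℤ, a < d → d ≤ a + 2 * n → ¬ Joins S a d → ¬ Blocked S a d →
      ∃ x y, Joins S x y ∧ Straddles n a d x y)
    (had : a < d) (hda : d ≤ a + 2 * n) (h : ¬ Joins S a d) : Blocked S a d := by
  by_contra hB
  obtain ⟨x, y, hxy, hst, hmax⟩ :=
    exists_longest_straddles hS hda hB (hstraddle a d had hda h hB)
  have hyx := hst.le_add hS hda hB hxy
  have hay : Joins S a y := by
    by_contra h
    exact not_blocked_of_longest_left hS hfree hB hxy hst hmax
      (blocked_of_forall_exists_straddles hS hfree hstraddle (by omega) (by omega) h)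
  have hxd : Joins S x (d + n) := by
    by_contra h
    exact not_blocked_of_longest_right hS hfree hB hxy hst hmax
      (blocked_of_forall_exists_straddles hS hfree hstraddle (by omega) (by omega) h)
  exact hfree.not_blocked hay
    ⟨x, a + n, d + n, y + n, by omega, hxd, hay.shift hS 1 (by ring) (by ring)⟩
termination_by (a + 2 * n - d).toNat
decreasing_by all_goals omega

end Blocking

section Triangulations

variable {n : ℕ} {E T : Set (CylinderEdge n)} {g u v w : Edge ℤ} {k l : ℤ}

theorem eq_add_one_or_of_translate_crosses (hg : g.length ≤ 2 * n)
    (h : (g.translate (k * n)).Crosses (g.translate (l * n))) : l = k + 1 ∨ k = l + 1 := by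
  obtain ⟨hne, hlt⟩ := Edge.translate_crosses_translate_iff.1 h
  have hg' : (g.length : ℤ) ≤ 2 * n := by exact_mod_cast hg
  rw [← sub_mul, abs_mul, Nat.abs_cast] at hlt
  have habs : |l - k| < 2 := lt_of_mul_lt_mul_right (hlt.trans_le hg') (by omega)
  have hkl : k ≠ l := ne_of_apply_ne (· * (n : ℤ)) hne
  rw [abs_lt] at habs
  omega

theorem exists_crosses_of_translate_crosses (hv : v ∈ lift n E) (hw : w ∈ lift n E)
    (hgv : (g.translate (k * n)).Crosses v) (hgw : (g.translate (k * n)).Crosses w)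
    (hvw : v.Crosses w) :
    ∃ v ∈ lift n E, ∃ w ∈ lift n E, g.Crosses v ∧ g.Crosses w ∧ v.Crosses w := by
  rw [Edge.translate_crosses_iff, ← neg_mul] at hgv hgw
  exact ⟨_, (translate_mem_lift_iff (-k)).2 hv, _, (translate_mem_lift_iff (-k)).2 hw, hgv, hgw,
    hvw.translate _⟩

theorem exists_crosses_of_translates_cross (hg : g.length ≤ 2 * n) (hw : w ∈ lift n E)
    (hkl : (g.translate (k * n)).Crosses (g.translate (l * n)))
    (hgw : (g.translate (k * n)).Crosses w) (hgw' : (g.translate (l * n)).Crosses w) :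
    ∃ w ∈ lift n E, g.Crosses (g.translate n) ∧ g.Crosses w ∧ (g.translate n).Crosses w := by
  wlog hlk : l = k + 1 generalizing k l
  · exact this hkl.symm hgw' hgw ((eq_add_one_or_of_translate_crosses hg hkl).resolve_left hlk)
  have hshift : g.translate (l * n) = (g.translate n).translate (k * n) := by
    rw [Edge.translate_translate, hlk, add_one_mul, add_comm]
  rw [hshift, Edge.translate_crosses_iff] at hgw'
  rw [hshift, Edge.translate_crosses_iff, Edge.translate_translate, add_neg_cancel,
    Edge.translate_zero] at hkl
  rw [Edge.translate_crosses_iff] at hgw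
  rw [← neg_mul] at hgw hgw'
  exact ⟨_, (translate_mem_lift_iff (-k)).2 hw, hkl, hgw, hgw'⟩

/-- A `3`-crossing created by adding the class of `g` to `T` uses one or two translates of `g`:
three pairwise crossing ones would have pairwise consecutive indices. -/
theorem IsCylinderTriangulation.exists_crosses (hT : IsCylinderTriangulation n 2 T)
    (hg : g.length ≤ 2 * n) (hgT : g ∉ lift n T) :
    (∃ v ∈ lift n T, ∃ w ∈ lift n T, g.Crosses v ∧ g.Crosses w ∧ v.Crosses w) ∨
      ∃ w ∈ lift n T, g.Crosses (g.translate n) ∧ g.Crosses w ∧ (g.translate n).Crosses w := by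
  have hcrossing : ¬ CrossingFree 3 (lift n (insert (proj n g) T)) := fun h =>
    hgT (hT.2 h (Set.subset_insert _ _) (Set.mem_insert _ _))
  simp only [crossingFree_three_iff, mem_lift_insert_iff] at hcrossing
  push Not at hcrossing
  obtain ⟨u, hu, v, hv, w, hw, huv, huw, hvw⟩ := hcrossing
  rcases hu with ⟨k, rfl⟩ | hu <;> rcases hv with ⟨l, rfl⟩ | hv <;> rcases hw with ⟨m, rfl⟩ | hw
  · have hkl := eq_add_one_or_of_translate_crosses hg huv
    have hkm := eq_add_one_or_of_translate_crosses hg huw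
    have hlm := eq_add_one_or_of_translate_crosses hg hvw
    omega
  · exact Or.inr (exists_crosses_of_translates_cross hg hw huv huw hvw)
  · exact Or.inr (exists_crosses_of_translates_cross hg hv huw huv hvw.symm)
  · exact Or.inl (exists_crosses_of_translate_crosses hv hw huv huw hvw)
  · exact Or.inr (exists_crosses_of_translates_cross hg hu hvw huv.symm huw.symm)
  · exact Or.inl (exists_crosses_of_translate_crosses hu hw huv.symm hvw huw)
  · exact Or.inl (exists_crosses_of_translate_crosses hu hv huw.symm hvw.symm huv)
  · exact absurd hvw (crossingFree_three_iff.1 hT.1 u hu v hv w hw huv huw)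

variable [NeZero n]

theorem lengthLE_of_crossingFree (hE : CrossingFree 3 (lift n E)) : LengthLE n (2 * n) E := by
  intro g hg
  by_contra! hlen
  have hn : (0 : ℤ) < n := by exact_mod_cast NeZero.pos n
  have hmem (k : ℤ) : g.translate (k * n) ∈ lift n E := (translate_mem_lift_iff k).2 hg
  refine crossingFree_three_iff.1 hE _ (hmem 0) _ (hmem 1) _ (hmem 2) ?_ ?_ ?_ <;>
    rw [Edge.translate_crosses_translate_iff, abs_lt] <;> omega

theorem IsCylinderTriangulation.exists_straddles (hT : IsCylinderTriangulation n 2 T) {a d : ℤ}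
    (had : a < d) (hda : d ≤ a + 2 * n) (h : ¬ Joins (toPolygon n T) a d)
    (hB : ¬ Blocked (toPolygon n T) a d) :
    ∃ x y, Joins (toPolygon n T) x y ∧ Straddles n a d x y := by
  have hlen := lengthLE_of_crossingFree hT.1
  obtain ⟨g, hval⟩ : ∃ g : Edge ℤ, g.1 = s(a, d) := ⟨Edge.mk a d had.ne, rfl⟩
  have hglen := Edge.length_eq_sub hval had
  have hgT : g ∉ lift n T := fun hg => by
    obtain ⟨e, he, hge⟩ := exists_mem_toPolygon_isLift hlen hg
    exact h ⟨e, he, hge.val_eq hval⟩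
  rcases hT.exists_crosses (by omega) hgT with
    ⟨v, hv, w, hw, hgv, hgw, hvw⟩ | ⟨w, hw, hgg, hgw, hgw'⟩
  · have hvlen := hlen v hv
    have hwlen := hlen w hw
    obtain ⟨e, hge⟩ := Edge.exists_isLift_of_length_le (N := 4 * n) (g := g) (by omega)
    obtain ⟨e₁, he₁, hve⟩ := exists_mem_toPolygon_isLift hlen hv
    obtain ⟨e₂, he₂, hwe⟩ := exists_mem_toPolygon_isLift hlen hw
    exact absurd (blocked_of_crosses had (by omega) (hge.val_eq hval) he₁ he₂
      (hgv.of_isLift hge hve (by omega) (by omega)) (hgw.of_isLift hge hwe (by omega) (by omega))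
      (hvw.of_isLift hve hwe (by omega) (by omega))) hB
  · obtain ⟨x, y, hxy, hwxy⟩ := w.exists_lt
    obtain ⟨e, he, hwe⟩ := exists_mem_toPolygon_isLift hlen hw
    have hwlen := hlen w hw
    have hyx := Edge.length_eq_sub hwxy hxy
    have hJ : Joins (toPolygon n T) x y := ⟨e, he, hwe.val_eq hwxy⟩
    exact ⟨x, y, hJ, straddles_of_crosses (isPeriodic_toPolygon T) hval hwxy had hda hxy
      (by omega) hB hJ hgg hgw hgw'⟩

theorem isPolygonTriangulation_toPolygon (hT : IsCylinderTriangulation n 2 T) :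
    IsPolygonTriangulation (4 * n) 2 (toPolygon n T) := by
  have hlen := lengthLE_of_crossingFree hT.1
  have hfree := (crossingFree_lift_iff hlen).1 hT.1
  refine hfree.maximal_three fun e he => ?_
  obtain ⟨g, hge, hg⟩ := exists_isLift_length_le e
  obtain ⟨a, d, had, hval⟩ := g.exists_lt
  have hda := Edge.length_eq_sub hval had
  have hnot : ¬ Joins (toPolygon n T) a d := by
    rintro ⟨f, hf, hfad⟩
    exact he (Subtype.ext ((hge.val_eq hval).trans hfad.symm) ▸ hf)
  have hB := blocked_of_forall_exists_straddles (isPeriodic_toPolygon T) hfree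
    (fun a d => hT.exists_straddles) had (by omega) hnot
  exact hB.exists_crosses (hge.val_eq hval)

theorem bijOn_toPolygon_triangulation :
    Set.BijOn (toPolygon n) {T | IsCylinderTriangulation n 2 T}
      {T | IsPolygonTriangulation (4 * n) 2 T ∧ IsPeriodic (4 * n) n T} := by
  refine ⟨fun T hT => ?_, bijOn_toPolygon_lengthLE.injOn.mono fun T hT => ?_, ?_⟩
  · exact ⟨isPolygonTriangulation_toPolygon hT, isPeriodic_toPolygon T⟩
  · exact lengthLE_of_crossingFree hT.1
  · rintro S ⟨hS, hper⟩
    obtain ⟨E, hE, rfl⟩ := bijOn_toPolygon_lengthLE.surjOn hper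
    refine ⟨E, ⟨(crossingFree_lift_iff hE).2 hS.1, fun F hF hEF => ?_⟩, rfl⟩
    have hFlen := lengthLE_of_crossingFree hF
    exact (toPolygon_subset_toPolygon_iff hFlen hE).1 (hS.2 ((crossingFree_lift_iff hFlen).1 hF)
      ((toPolygon_subset_toPolygon_iff hE hFlen).2 hEF))

end Triangulations

end HalfCylinder

open HalfCylinder in
theorem mainTheorem4 (n : ℕ) (hn : 0 < n) :
    -- `φ` is a bijection from 2-triangulations on `C_n` to `n`-periodic ones of the `4n`-gon
    Set.BijOn (toPolygon n)
      {T | IsCylinderTriangulation n 2 T}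
      {T | IsPolygonTriangulation (4 * n) 2 T ∧ IsPeriodic (4 * n) n T} ∧
    -- `φ` is a bijection from sets of edges of length at most `2n` to `n`-periodic sets of edges
    Set.BijOn (toPolygon n) {E | LengthLE n (2 * n) E} {S | IsPeriodic (4 * n) n S} ∧
    -- reduction modulo `4n` sends 3-crossings of lifted edges to 3-crossings
    (∀ C : Set (Edge ℤ), (∀ e ∈ C, e.length ≤ 2 * n) → IsCrossing 3 C →
      IsCrossing 3 (reduceMod (4 * n) C)) ∧
    -- `φ` and its inverse preserve 3-crossings
    (∀ E : Set (CylinderEdge n), LengthLE n (2 * n) E →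
      (IsCylinderCrossing n 3 E ↔
        ∃ C, IsCrossing 3 C ∧ toPolygon n E = rotationOrbit (4 * n) n C)) ∧
    -- hence `φ` preserves and reflects being 3-crossing-free
    (∀ E : Set (CylinderEdge n), LengthLE n (2 * n) E →
      (CrossingFree 3 (lift n E) ↔ CrossingFree 3 (toPolygon n E))) := by
  have : NeZero n := ⟨hn.ne'⟩
  exact ⟨bijOn_toPolygon_triangulation, bijOn_toPolygon_lengthLE,
    fun C hlen hC => hC.reduceMod fun g hg => by linarith [hlen g hg],
    fun E hE => isCylinderCrossing_iff hE, fun E hE => crossingFree_lift_iff hE⟩
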